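/- Let $k,d\ge 0$ be integers, let $\mathrm{NN}:\mathbb{R}^k\to\mathbb{R}^d$ be Lipschitz with Lipschitz constant $L_2\ge 0$ (Euclidean norms), and let $\Sigma\in\mathbb{R}^{d\times d}$ be a symmetric positive semidefinite matrix. Let $(Z,X)$ be a pair of random vectors in $\mathbb{R}^k\times\mathbb{R}^d$ with $Z\sim\mathcal{N}(0,I)$ and, conditionally on $Z=z$, $X\sim\mathcal{N}(\mathrm{NN}(z),\Sigma)$, and assume $\mathbb{E}\|\mathrm{NN}(Z)\|<\infty$. Put $s=\sqrt{\operatorname{tr}\Sigma}$ and $L_1=\|\Sigma^{1/2}\|_{\mathrm{op}}$. Then $\mathbb{E}\|X\|<\infty$ and, for every $t>2s$, $$ P\bigl(\bigl|\|X\|-\mathbb{E}\|X\|\bigr|\ge t\bigr)\le 2\left(\exp\Bigl(-\frac{t^2}{8L_1^2}\Bigr)+\exp\Bigl(-\frac{(t/2-s)^2}{2L_2^2}\Bigr)\right), $$ where an exponential whose denominator is $0$ is read as its limiting value $0$. Consequently $X$ has Gaussian-type tails: there are constants $C,c>0$ (depending on the model) such that $P(\|X\|\ge t)\le C e^{-ct^2}$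 for all $t\ge 0$. -/

import Mathlib

open MeasureTheory ProbabilityTheory
open scoped NNReal MatrixOrder

namespace GaussianLatentModel

theorem measurable_multivariateGaussian {k d : ℕ}
    {f : EuclideanSpace ℝ (Fin k) → EuclideanSpace ℝ (Fin d)} (hf : Measurable f)
    (S : Matrix (Fin d) (Fin d) ℝ) :
    Measurable fun z => multivariateGaussian (f z) S := by
  refine Measure.measurable_of_measurable_coe _ fun A hA => ?_
  have hg : Measurable fun p : EuclideanSpace ℝ (Fin k) × EuclideanSpace ℝ (Fin d) =>
      f p.1 + Matrix.toEuclideanCLM (𝕜 := ℝ) (CFC.sqrt S) p.2 := by fun_prop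
  have h := measurable_measure_prodMk_left
    (ν := stdGaussian (EuclideanSpace ℝ (Fin d))) (hg hA)
  have he : ∀ z, multivariateGaussian (f z) S A = stdGaussian (EuclideanSpace ℝ (Fin d))
      (Prod.mk z ⁻¹' ((fun p : EuclideanSpace ℝ (Fin k) × EuclideanSpace ℝ (Fin d) =>
        f p.1 + Matrix.toEuclideanCLM (𝕜 := ℝ) (CFC.sqrt S) p.2) ⁻¹' A)) := by
    intro z
    rw [multivariateGaussian, Measure.map_apply (by fun_prop) hA]
    rfl
  simpa only [he] using h

/-- The conditional law `x | z ~ N(f z, S)`, as a Markov kernel. -/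
noncomputable def likelihood {k d : ℕ}
    (f : EuclideanSpace ℝ (Fin k) → EuclideanSpace ℝ (Fin d)) (hf : Measurable f)
    (S : Matrix (Fin d) (Fin d) ℝ) :
    Kernel (EuclideanSpace ℝ (Fin k)) (EuclideanSpace ℝ (Fin d)) where
  toFun z := multivariateGaussian (f z) S
  measurable' := measurable_multivariateGaussian hf S

instance {k d : ℕ}
    (f : EuclideanSpace ℝ (Fin k) → EuclideanSpace ℝ (Fin d)) (hf : Measurable f)
    (S : Matrix (Fin d) (Fin d) ℝ) : IsMarkovKernel (likelihood f hf S) :=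
  ⟨fun z => inferInstanceAs (IsProbabilityMeasure (multivariateGaussian (f z) S))⟩

/-- The joint law of `(z, x)` in the model `z ~ N(0, I)`, `x | z ~ N(f z, S)`. -/
noncomputable def joint {k d : ℕ}
    (f : EuclideanSpace ℝ (Fin k) → EuclideanSpace ℝ (Fin d)) (hf : Measurable f)
    (S : Matrix (Fin d) (Fin d) ℝ) :
    Measure (EuclideanSpace ℝ (Fin k) × EuclideanSpace ℝ (Fin d)) :=
  stdGaussian (EuclideanSpace ℝ (Fin k)) ⊗ₘ likelihood f hf S

/-- `exp (-a / b)` for `a > 0` and `b ≥ 0`, with its limiting value `0` at `b = 0`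
(whereas `a / 0 = 0` in Lean would give `1`). -/
noncomputable def expNegDiv (a b : ℝ) : ℝ :=
  if b = 0 then 0 else Real.exp (-(a / b))

end GaussianLatentModel

open scoped ENNReal

namespace GaussianLatentModel

/-! The vector `X` is distributed as `NN z + S^{1/2} w` with `z`, `w` independent standard
Gaussians, so its norm is a function of `(z, w)` that is `L₂`-Lipschitz in `z` and `L₁`-Lipschitz in
`w`. Gaussian concentration is obtained by Maurey's route: Brunn–Minkowski on the line gives
Prékopa–Leindler, which gives property (τ) of the one-dimensional Gaussian for the cost `(x - y)² /
4`. Property (τ) tensorizes, so it holds in every dimension without loss of constants, and testing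
it on `exp (± l f)` bounds the moment generating function of `f - E f`.

This makes `‖X‖ - E ‖X‖` sub-Gaussian with parameter `2 (L₁² + L₂²)`, hence with tail `2 exp (-t² /
(4 (L₁² + L₂²)))`. The term of the claimed bound that belongs to the larger of `L₁`, `L₂` already
dominates this; the shift by `s` only weakens the claim. -/

/-! ### Brunn–Minkowski and Prékopa–Leindler on the line. -/

/-- One-dimensional Brunn–Minkowski for compact sets. -/
theorem volume_add_le_of_isCompact {A B C : Set ℝ} (hA : IsCompact A) (hB : IsCompact B)
    (hA₀ : A.Nonempty) (hB₀ : B.Nonempty) (hC : ∀ x ∈ A, ∀ y ∈ B, x + y ∈ C) :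
    volume A + volume B ≤ volume C := by
  -- With `a = max A` and `b = min B`, the translates `A + b` and `a + B` lie in `C` on either side
  -- of `a + b`, so they overlap in at most that point.
  obtain ⟨a, ha, hamax⟩ := hA.exists_isGreatest hA₀
  obtain ⟨b, hb, hbmin⟩ := hB.exists_isLeast hB₀
  have hB' : MeasurableSet ((fun x => x + -a) ⁻¹' B) :=
    (measurable_add_const (-a)) hB.measurableSet
  have hdisj : AEDisjoint volume ((fun x => x + -b) ⁻¹' A) ((fun x => x + -a) ⁻¹' B) := by
    refine measure_mono_null (t := {a + b}) ?_ (by simp)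
    rintro x ⟨h₁, h₂⟩
    have h₁ := hamax h₁
    have h₂ := hbmin h₂
    simp only [Set.mem_singleton_iff]
    linarith
  calc volume A + volume B
      = volume ((fun x => x + -b) ⁻¹' A) + volume ((fun x => x + -a) ⁻¹' B) := by
        rw [measure_preimage_add_right, measure_preimage_add_right]
    _ = volume (((fun x => x + -b) ⁻¹' A) ∪ ((fun x => x + -a) ⁻¹' B)) :=
        (measure_union₀ hB'.nullMeasurableSet hdisj).symm
    _ ≤ volume C := by
        refine measure_mono ?_
        rintro x (hx | hx)
        · simpa using hC _ hx _ hb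
        · simpa [add_comm] using hC _ ha _ hx

/-- One-dimensional Brunn–Minkowski for measurable sets. -/
theorem volume_add_le {A B C : Set ℝ} (hA : MeasurableSet A) (hB : MeasurableSet B)
    (hA₀ : A.Nonempty) (hB₀ : B.Nonempty) (hC : ∀ x ∈ A, ∀ y ∈ B, x + y ∈ C) :
    volume A + volume B ≤ volume C := by
  obtain ⟨a, ha⟩ := hA₀
  obtain ⟨b, hb⟩ := hB₀
  have key : ∀ K, K ⊆ A → IsCompact K → ∀ L, L ⊆ B → IsCompact L →
      volume K + volume L ≤ volume C := by
    intro K hKA hK L hLB hL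
    -- Inserting fixed points of `A` and `B` keeps the compact pieces nonempty.
    refine le_trans (add_le_add (measure_mono (Set.subset_insert a K))
      (measure_mono (Set.subset_insert b L))) ?_
    refine volume_add_le_of_isCompact (hK.insert a) (hL.insert b) (Set.insert_nonempty _ _)
      (Set.insert_nonempty _ _) fun x hx y hy => hC x ?_ y ?_
    · exact Set.insert_subset ha hKA hx
    · exact Set.insert_subset hb hLB hy
  have key₂ : ∀ K, K ⊆ A → IsCompact K → volume K + volume B ≤ volume C := by
    intro K hKA hK
    rw [add_comm]
    refine add_le_of_le_tsub_right_of_le ((le_add_right le_rfl).trans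
      (key K hKA hK ∅ (Set.empty_subset _) isCompact_empty)) ?_
    rw [hB.measure_eq_iSup_isCompact]
    refine iSup_le fun L => iSup_le fun hLB => iSup_le fun hL => ?_
    refine ENNReal.le_sub_of_add_le_right hK.measure_lt_top.ne ?_
    rw [add_comm]
    exact key K hKA hK L hLB hL
  by_cases hBtop : volume B = ∞
  · simpa [hBtop] using key₂ ∅ (Set.empty_subset _) isCompact_empty
  refine add_le_of_le_tsub_right_of_le ((le_add_left le_rfl).trans
    (key₂ ∅ (Set.empty_subset _) isCompact_empty)) ?_
  rw [hA.measure_eq_iSup_isCompact]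
  exact iSup_le fun K => iSup_le fun hKA => iSup_le fun hK =>
    ENNReal.le_sub_of_add_le_right hBtop (key₂ K hKA hK)

/-- One-dimensional Prékopa–Leindler, for functions with supremum `1`. -/
theorem lintegral_add_le_of_mul_le_sq {f g h : ℝ → ℝ} (hf : Measurable f) (hg : Measurable g)
    (hh : Measurable h) (hf₀ : ∀ x, 0 ≤ f x) (hg₀ : ∀ x, 0 ≤ g x) (hh₀ : ∀ x, 0 ≤ h x)
    (hf₁ : IsLUB (Set.range f) 1) (hg₁ : IsLUB (Set.range g) 1)
    (hfg : ∀ x y, f x * g y ≤ h (x + y) ^ 2) :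
    (∫⁻ x, ENNReal.ofReal (f x)) + ∫⁻ x, ENNReal.ofReal (g x) ≤ ∫⁻ x, ENNReal.ofReal (h x) := by
  rw [lintegral_eq_lintegral_meas_lt _ (ae_of_all _ hf₀) hf.aemeasurable,
    lintegral_eq_lintegral_meas_lt _ (ae_of_all _ hg₀) hg.aemeasurable,
    lintegral_eq_lintegral_meas_lt _ (ae_of_all _ hh₀) hh.aemeasurable]
  have hanti : Measurable fun t : ℝ => volume {x | t < f x} :=
    (show Antitone fun t : ℝ => volume {x | t < f x} from
      fun t u htu => measure_mono fun x hx => htu.trans_lt hx).measurable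
  rw [← lintegral_add_left hanti]
  refine setLIntegral_mono' measurableSet_Ioi fun t (ht : 0 < t) => ?_
  -- The common supremum `1` makes the level sets of `f` and `g` nonempty for exactly the same `t`,
  -- so Brunn–Minkowski applies at each level below `1`.
  rcases lt_or_ge t 1 with ht₁ | ht₁
  · obtain ⟨_, ⟨x, rfl⟩, hx, -⟩ := hf₁.exists_between ht₁
    obtain ⟨_, ⟨y, rfl⟩, hy, -⟩ := hg₁.exists_between ht₁
    refine volume_add_le (measurableSet_lt measurable_const hf)
      (measurableSet_lt measurable_const hg) ⟨x, hx⟩ ⟨y, hy⟩ ?_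
    intro x (hx : t < f x) y (hy : t < g y)
    refine lt_of_pow_lt_pow_left₀ 2 (hh₀ _) (lt_of_lt_of_le ?_ (hfg x y))
    rw [sq]
    exact mul_lt_mul'' hx hy ht.le ht.le
  · have h₁ : {x | t < f x} = ∅ :=
      Set.eq_empty_of_forall_notMem fun x hx => (ht₁.trans_lt hx).not_ge (hf₁.1 ⟨x, rfl⟩)
    have h₂ : {x | t < g x} = ∅ :=
      Set.eq_empty_of_forall_notMem fun x hx => (ht₁.trans_lt hx).not_ge (hg₁.1 ⟨x, rfl⟩)
    simp [h₁, h₂]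

/-- One-dimensional Prékopa–Leindler with midpoint interpolation. -/
theorem four_mul_lintegral_mul_le_sq {f g h : ℝ → ℝ} (hf : Measurable f) (hg : Measurable g)
    (hh : Measurable h) (hf₀ : ∀ x, 0 ≤ f x) (hg₀ : ∀ x, 0 ≤ g x) (hh₀ : ∀ x, 0 ≤ h x)
    {M : ℝ} (hhM : ∀ x, h x ≤ M)
    (hfg : ∀ x y, f x * g y ≤ h (x + y) ^ 2) :
    4 * ((∫⁻ x, ENNReal.ofReal (f x)) * ∫⁻ x, ENNReal.ofReal (g x)) ≤
      (∫⁻ x, ENNReal.ofReal (h x)) ^ 2 := by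
  by_cases hfz : ∀ x, f x = 0
  · simp [hfz]
  by_cases hgz : ∀ x, g x = 0
  · simp [hgz]
  push Not at hfz hgz
  obtain ⟨x₀, hx₀⟩ := hfz
  obtain ⟨y₀, hy₀⟩ := hgz
  replace hx₀ : 0 < f x₀ := (hf₀ x₀).lt_of_ne' hx₀
  replace hy₀ : 0 < g y₀ := (hg₀ y₀).lt_of_ne' hy₀
  have hM : ∀ x y, f x * g y ≤ M ^ 2 := fun x y =>
    (hfg x y).trans (pow_le_pow_left₀ (hh₀ _) (hhM _) 2)
  have hfb : BddAbove (Set.range f) := by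
    refine ⟨M ^ 2 / g y₀, ?_⟩
    rintro _ ⟨x, rfl⟩
    exact (le_div_iff₀ hy₀).2 (hM x y₀)
  have hgb : BddAbove (Set.range g) := by
    refine ⟨M ^ 2 / f x₀, ?_⟩
    rintro _ ⟨y, rfl⟩
    exact (le_div_iff₀' hx₀).2 (hM x₀ y)
  have norm_lub : ∀ {u : ℝ → ℝ}, BddAbove (Set.range u) → 0 < sSup (Set.range u) →
      IsLUB (Set.range fun x => u x / sSup (Set.range u)) 1 := by
    intro u hu hpos
    have hl := isLUB_csSup (Set.range_nonempty u) hu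
    constructor
    · rintro _ ⟨x, rfl⟩
      exact (div_le_one hpos).2 (hl.1 ⟨x, rfl⟩)
    · intro c hc
      have : sSup (Set.range u) ≤ c * sSup (Set.range u) := by
        refine hl.2 ?_
        rintro _ ⟨x, rfl⟩
        exact (div_le_iff₀ hpos).1 (hc ⟨x, rfl⟩)
      nlinarith
  have ha : 0 < sSup (Set.range f) := hx₀.trans_le (le_csSup hfb ⟨x₀, rfl⟩)
  have hb : 0 < sSup (Set.range g) := hy₀.trans_le (le_csSup hgb ⟨y₀, rfl⟩)
  have hfl := norm_lub hfb ha
  have hgl := norm_lub hgb hb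
  set a := sSup (Set.range f)
  set b := sSup (Set.range g)
  -- Dividing `h` by `√(a * b)` preserves the hypothesis when `f`, `g` are divided by their suprema.
  have hc : 0 < √(a * b) := Real.sqrt_pos.2 (mul_pos ha hb)
  have key := lintegral_add_le_of_mul_le_sq (f := fun x => f x / a) (g := fun x => g x / b)
    (h := fun x => h x / √(a * b)) (by fun_prop) (by fun_prop) (by fun_prop)
    (fun x => div_nonneg (hf₀ x) ha.le) (fun x => div_nonneg (hg₀ x) hb.le)
    (fun x => div_nonneg (hh₀ x) hc.le) hfl hgl (fun x y => by
      rw [div_pow, Real.sq_sqrt (mul_pos ha hb).le, div_mul_div_comm]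
      exact div_le_div_of_nonneg_right (hfg x y) (mul_pos ha hb).le)
  have scale : ∀ (u : ℝ → ℝ) {r : ℝ}, Measurable u → 0 < r →
      ∫⁻ x, ENNReal.ofReal (u x / r) = (∫⁻ x, ENNReal.ofReal (u x)) / ENNReal.ofReal r := by
    intro u r hu hr
    simp_rw [ENNReal.ofReal_div_of_pos hr, div_eq_mul_inv]
    rw [lintegral_mul_const _ (by fun_prop)]
  rw [scale f hf ha, scale g hg hb, scale h hh hc] at key
  by_cases hI : ∫⁻ x, ENNReal.ofReal (h x) = ∞
  · simp [hI]
  have hlt : (∫⁻ x, ENNReal.ofReal (h x)) / ENNReal.ofReal √(a * b) < ∞ :=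
    ENNReal.div_lt_top hI (by simpa using hc)
  have hFtop : ∫⁻ x, ENNReal.ofReal (f x) ≠ ∞ := by
    intro h'
    rw [h', ENNReal.top_div_of_ne_top ENNReal.ofReal_ne_top, top_add] at key
    exact hlt.not_ge key
  have hGtop : ∫⁻ x, ENNReal.ofReal (g x) ≠ ∞ := by
    intro h'
    rw [h', ENNReal.top_div_of_ne_top ENNReal.ofReal_ne_top, add_top] at key
    exact hlt.not_ge key
  generalize ∫⁻ x, ENNReal.ofReal (h x) = H at *
  generalize ∫⁻ x, ENNReal.ofReal (f x) = F at *
  generalize ∫⁻ x, ENNReal.ofReal (g x) = G at *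
  lift H to ℝ≥0 using hI
  lift F to ℝ≥0 using hFtop
  lift G to ℝ≥0 using hGtop
  have hdiv : ∀ (u : ℝ≥0) {r : ℝ}, 0 < r →
      (u : ℝ≥0∞) / ENNReal.ofReal r = ENNReal.ofReal (u / r) := by
    intro u r hr
    rw [ENNReal.ofReal_div_of_pos hr, ENNReal.ofReal_coe_nnreal]
  rw [hdiv F ha, hdiv G hb, hdiv H hc, ← ENNReal.ofReal_add (by positivity) (by positivity),
    ENNReal.ofReal_le_ofReal_iff (by positivity)] at key
  have key₂ : ((F : ℝ) / a + G / b) ^ 2 ≤ (H / √(a * b)) ^ 2 :=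
    pow_le_pow_left₀ (by positivity) key 2
  -- AM–GM, `4uv ≤ (u + v)²`, turns the additive bound into the multiplicative one.
  have key₃ : 4 * ((F : ℝ) / a * (G / b)) ≤ (H : ℝ) ^ 2 / (a * b) := by
    rw [div_pow, Real.sq_sqrt (mul_pos ha hb).le] at key₂
    nlinarith [sq_nonneg ((F : ℝ) / a - G / b)]
  rw [div_mul_div_comm, ← mul_div_assoc, div_le_div_iff_of_pos_right (mul_pos ha hb)] at key₃
  exact_mod_cast key₃

/-! ### Property (τ): tensorization, the Gaussian case, concentration. -/

/-- Maurey's property (τ), in its symmetric form, of a measure `μ` with respect to a cost `c`. -/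
def PropertyTau {α : Type*} [MeasurableSpace α] (μ : Measure α) (c : α → α → ℝ) : Prop :=
  ∀ F G : α → ℝ≥0∞, Measurable F → Measurable G →
    (∀ x y, F x * G y ≤ ENNReal.ofReal (Real.exp (c x y))) →
    (∫⁻ x, F x ∂μ) * ∫⁻ x, G x ∂μ ≤ 1

namespace PropertyTau

variable {α β : Type*} [MeasurableSpace α] [MeasurableSpace β]

theorem map {μ : Measure α} {c : α → α → ℝ} {c' : β → β → ℝ} (h : PropertyTau μ c) {φ : α → β}
    (hφ : Measurable φ) (hc : ∀ x y, c' (φ x) (φ y) ≤ c x y) : PropertyTau (μ.map φ) c' := by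
  intro F G hF hG hFG
  rw [lintegral_map hF hφ, lintegral_map hG hφ]
  exact h _ _ (hF.comp hφ) (hG.comp hφ) fun x y => (hFG _ _).trans
    (ENNReal.ofReal_le_ofReal (Real.exp_le_exp.2 (hc x y)))

/-- For fixed `x`, `y`, the functions `exp (-c x y) * F (x, ·)` and `G (y, ·)` are admissible for
`c'`. The resulting bound says that the partial integrals of `F` and `G` are admissible for `c`. -/
theorem prod {μ : Measure α} {ν : Measure β} [SFinite μ] [SFinite ν] {c : α → α → ℝ}
    {c' : β → β → ℝ} (hμ : PropertyTau μ c) (hν : PropertyTau ν c') :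
    PropertyTau (μ.prod ν) fun p q => c p.1 q.1 + c' p.2 q.2 := by
  intro F G hF hG hFG
  rw [lintegral_prod _ hF.aemeasurable, lintegral_prod _ hG.aemeasurable]
  refine hμ _ _ hF.lintegral_prod_right' hG.lintegral_prod_right' fun x y => ?_
  have he : ENNReal.ofReal (Real.exp (-c x y)) * ENNReal.ofReal (Real.exp (c x y)) = 1 := by
    rw [← ENNReal.ofReal_mul (Real.exp_pos _).le, ← Real.exp_add]
    simp
  have h := hν (fun z => ENNReal.ofReal (Real.exp (-c x y)) * F (x, z)) (fun z => G (y, z))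
    (by fun_prop) (by fun_prop) (fun z w => by
      rw [mul_assoc]
      refine (mul_le_mul_right (hFG (x, z) (y, w)) _).trans ?_
      rw [← ENNReal.ofReal_mul (Real.exp_pos _).le, ← Real.exp_add]
      simp)
  rw [lintegral_const_mul _ (by fun_prop), mul_assoc] at h
  calc (∫⁻ z, F (x, z) ∂ν) * ∫⁻ z, G (y, z) ∂ν
      = ENNReal.ofReal (Real.exp (c x y)) * (ENNReal.ofReal (Real.exp (-c x y)) *
          ((∫⁻ z, F (x, z) ∂ν) * ∫⁻ z, G (y, z) ∂ν)) := by
        rw [← mul_assoc, mul_comm (ENNReal.ofReal (Real.exp (c x y))), he, one_mul]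
    _ ≤ ENNReal.ofReal (Real.exp (c x y)) := mul_le_of_le_one_right' h

theorem pi {μ : Measure ℝ} [IsProbabilityMeasure μ] {c : ℝ → ℝ → ℝ} (h : PropertyTau μ c) :
    ∀ n : ℕ, PropertyTau (Measure.pi fun _ : Fin n => μ) fun x y => ∑ i, c (x i) (y i)
  | 0 => by
    intro F G hF hG hFG
    rw [Measure.pi_of_empty _ (fun i => isEmptyElim i), lintegral_dirac' _ hF, lintegral_dirac' _ hG]
    simpa using hFG (fun i => isEmptyElim i) (fun i => isEmptyElim i)
  | n + 1 => by
    have hm := (measurePreserving_piFinSuccAbove (fun _ : Fin (n + 1) => μ) 0).symm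
    rw [← hm.map_eq]
    refine (h.prod (pi h n)).map hm.measurable fun x y => ?_
    rw [Fin.sum_univ_succ]
    simp [MeasurableEquiv.piFinSuccAbove_symm_apply, Fin.insertNthEquiv]

/-- Prékopa–Leindler applied to `F` and `G` times the Gaussian weight: by the parallelogram
identity, `(x - y)² / 4 - x² / 2 - y² / 2 = -(x + y)² / 4`, which is the exponent of `h (x + y) ^
2`. -/
theorem gaussianReal : PropertyTau (gaussianReal 0 1) fun x y => (x - y) ^ 2 / 4 := by
  intro F G hF hG hFG
  by_cases hFz : ∀ x, F x = 0
  · simp [hFz]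
  by_cases hGz : ∀ x, G x = 0
  · simp [hGz]
  push Not at hFz hGz
  obtain ⟨x₀, hx₀⟩ := hFz
  obtain ⟨y₀, hy₀⟩ := hGz
  have hFt : ∀ x, F x ≠ ∞ := by
    intro x hx
    have := hFG x y₀
    rw [hx, ENNReal.top_mul hy₀] at this
    exact ENNReal.ofReal_ne_top (top_le_iff.1 this)
  have hGt : ∀ x, G x ≠ ∞ := by
    intro x hx
    have := hFG x₀ x
    rw [hx, ENNReal.mul_top hx₀] at this
    exact ENNReal.ofReal_ne_top (top_le_iff.1 this)
  have hprod : ∀ x y, (F x).toReal * (G y).toReal ≤ Real.exp ((x - y) ^ 2 / 4) := by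
    intro x y
    rw [← ENNReal.toReal_mul]
    exact ENNReal.toReal_le_of_le_ofReal (Real.exp_pos _).le (hFG x y)
  have key := four_mul_lintegral_mul_le_sq
    (f := fun x => (F x).toReal * Real.exp (-x ^ 2 / 2))
    (g := fun x => (G x).toReal * Real.exp (-x ^ 2 / 2))
    (h := fun x => Real.exp (-(1 / 8) * x ^ 2)) (M := 1)
    (by fun_prop) (by fun_prop) (by fun_prop) (fun x => by positivity) (fun x => by positivity)
    (fun x => by positivity) (fun x => Real.exp_le_one_iff.2 (by nlinarith [sq_nonneg x]))
    (fun x y => by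
      calc (F x).toReal * Real.exp (-x ^ 2 / 2) * ((G y).toReal * Real.exp (-y ^ 2 / 2))
          = (F x).toReal * (G y).toReal * Real.exp (-x ^ 2 / 2 + -y ^ 2 / 2) := by
            rw [Real.exp_add]; ring
        _ ≤ Real.exp ((x - y) ^ 2 / 4) * Real.exp (-x ^ 2 / 2 + -y ^ 2 / 2) :=
            mul_le_mul_of_nonneg_right (hprod x y) (Real.exp_pos _).le
        _ = Real.exp (-(1 / 8) * (x + y) ^ 2) ^ 2 := by
            rw [← Real.exp_add, ← Real.exp_nat_mul]
            congr 1
            push_cast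
            ring)
  have hπ : 0 < 2 * Real.pi := by positivity
  -- The factor `4` here cancels the one in Prékopa–Leindler, and `2π` is the square of the Gaussian
  -- normalization.
  have hH : (∫⁻ x : ℝ, ENNReal.ofReal (Real.exp (-(1 / 8) * x ^ 2))) ^ 2 =
      ENNReal.ofReal (4 * (2 * Real.pi)) := by
    rw [← ofReal_integral_eq_lintegral_ofReal (integrable_exp_neg_mul_sq (by norm_num))
      (ae_of_all _ fun x => (Real.exp_pos _).le), integral_gaussian,
      ← ENNReal.ofReal_pow (Real.sqrt_nonneg _), Real.sq_sqrt (by positivity)]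
    congr 1
    ring
  have hI : ∀ u : ℝ → ℝ≥0∞, Measurable u → (∀ x, u x ≠ ∞) →
      ∫⁻ x, u x ∂(ProbabilityTheory.gaussianReal 0 1) = ENNReal.ofReal (√(2 * Real.pi))⁻¹ *
        ∫⁻ x, ENNReal.ofReal ((u x).toReal * Real.exp (-x ^ 2 / 2)) := by
    intro u hu hut
    rw [gaussianReal_of_var_ne_zero _ one_ne_zero,
      lintegral_withDensity_eq_lintegral_mul _ (measurable_gaussianPDF _ _) hu,
      ← lintegral_const_mul _ (by fun_prop)]
    refine lintegral_congr fun x => ?_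
    rw [Pi.mul_apply, gaussianPDF, gaussianPDFReal, ENNReal.ofReal_mul (by positivity),
      ENNReal.ofReal_mul ENNReal.toReal_nonneg, ENNReal.ofReal_toReal (hut x)]
    simp only [NNReal.coe_one, mul_one, sub_zero]
    ring
  rw [hH, ENNReal.ofReal_mul (by norm_num), ENNReal.ofReal_ofNat,
    ENNReal.mul_le_mul_iff_right (by norm_num) (by norm_num)] at key
  rw [hI F hF hFt, hI G hG hGt, mul_mul_mul_comm, ← ENNReal.ofReal_mul (by positivity),
    ← mul_inv, Real.mul_self_sqrt hπ.le]
  refine (mul_le_mul_right key _).trans ?_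
  rw [← ENNReal.ofReal_mul (by positivity), inv_mul_cancel₀ hπ.ne', ENNReal.ofReal_one]

theorem stdGaussian (n : ℕ) :
    PropertyTau (stdGaussian (EuclideanSpace ℝ (Fin n))) fun x y => ‖x - y‖ ^ 2 / 4 := by
  rw [← map_pi_eq_stdGaussian]
  refine (gaussianReal.pi n).map (by fun_prop) fun x y => ?_
  rw [EuclideanSpace.real_norm_sq_eq, Finset.sum_div]
  rfl

/-- Property (τ) gives sub-Gaussian concentration of functions compatible with the cost. -/
theorem hasSubgaussianMGF {μ : Measure α} [IsProbabilityMeasure μ] {c : α → α → ℝ}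
    (h : PropertyTau μ c) {f : α → ℝ} (hf : Measurable f) {V : ℝ≥0}
    (hV : ∀ (l : ℝ) x y, l * (f x - f y) ≤ l ^ 2 * V + c x y) :
    Integrable f μ ∧ HasSubgaussianMGF (fun x => f x - ∫ y, f y ∂μ) (2 * V) μ := by
  -- Property (τ) for `exp (l f - l² V)` and `exp (-l f)`.
  have key : ∀ l : ℝ, (∫⁻ x, ENNReal.ofReal (Real.exp (l * f x)) ∂μ) *
      ∫⁻ x, ENNReal.ofReal (Real.exp (-l * f x)) ∂μ ≤ ENNReal.ofReal (Real.exp (l ^ 2 * V)) := by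
    intro l
    have := h (fun x => ENNReal.ofReal (Real.exp (-(l ^ 2 * V))) *
        ENNReal.ofReal (Real.exp (l * f x)))
      (fun x => ENNReal.ofReal (Real.exp (-l * f x))) (by fun_prop) (by fun_prop) (fun x y => by
        rw [← ENNReal.ofReal_mul (by positivity), ← ENNReal.ofReal_mul (by positivity),
          ← Real.exp_add, ← Real.exp_add]
        refine ENNReal.ofReal_le_ofReal (Real.exp_le_exp.2 ?_)
        linarith [hV l x y])
    rw [lintegral_const_mul _ (by fun_prop), mul_assoc] at this
    calc _ = ENNReal.ofReal (Real.exp (l ^ 2 * V)) * (ENNReal.ofReal (Real.exp (-(l ^ 2 * V))) *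
          ((∫⁻ x, ENNReal.ofReal (Real.exp (l * f x)) ∂μ) *
            ∫⁻ x, ENNReal.ofReal (Real.exp (-l * f x)) ∂μ)) := by
          rw [← mul_assoc, ← ENNReal.ofReal_mul (by positivity), ← Real.exp_add]
          simp
      _ ≤ _ := mul_le_of_le_one_right' this
  have hexp : ∀ l : ℝ, Integrable (fun x => Real.exp (l * f x)) μ := by
    intro l
    -- A finite product with a nonzero factor has its other factor finite, so exponential
    -- integrability comes for free.
    have hne : ∫⁻ x, ENNReal.ofReal (Real.exp (-l * f x)) ∂μ ≠ 0 := by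
      intro h0
      rw [lintegral_eq_zero_iff (by fun_prop)] at h0
      obtain ⟨x, hx⟩ := h0.exists
      simp only [Pi.zero_apply, ENNReal.ofReal_eq_zero] at hx
      exact (Real.exp_pos _).not_ge hx
    have hlt : ∫⁻ x, ENNReal.ofReal (Real.exp (l * f x)) ∂μ ≠ ∞ := by
      intro htop
      have := key l
      rw [htop, ENNReal.top_mul hne] at this
      exact ENNReal.ofReal_ne_top (top_le_iff.1 this)
    refine ⟨by fun_prop, ?_⟩
    rw [hasFiniteIntegral_iff_ofReal (ae_of_all _ fun x => (Real.exp_pos _).le)]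
    exact hlt.lt_top
  have hint : Integrable f μ := by
    refine ((hexp 1).add (hexp (-1))).mono' hf.aestronglyMeasurable (ae_of_all _ fun x => ?_)
    simp only [Pi.add_apply, one_mul, neg_mul, Real.norm_eq_abs]
    rw [abs_le]
    constructor
    · linarith [Real.add_one_le_exp (-f x), Real.exp_pos (f x)]
    · linarith [Real.add_one_le_exp (f x), Real.exp_pos (-f x)]
  refine ⟨hint, fun t => ?_, fun t => ?_⟩
  · simp_rw [mul_sub, Real.exp_sub]
    exact (hexp t).div_const _
  · have hmul : (∫ x, Real.exp (t * f x) ∂μ) * ∫ x, Real.exp (-t * f x) ∂μ ≤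
        Real.exp (t ^ 2 * V) := by
      have := key t
      rwa [← ofReal_integral_eq_lintegral_ofReal (hexp t) (ae_of_all _ fun x => (Real.exp_pos _).le),
        ← ofReal_integral_eq_lintegral_ofReal (hexp (-t))
          (ae_of_all _ fun x => (Real.exp_pos _).le),
        ← ENNReal.ofReal_mul (integral_nonneg fun x => (Real.exp_pos _).le),
        ENNReal.ofReal_le_ofReal_iff (Real.exp_pos _).le] at this
    -- Jensen replaces the second factor by `exp (-t E f)`, which centres the first.
    have hjensen : Real.exp (-t * ∫ x, f x ∂μ) ≤ ∫ x, Real.exp (-t * f x) ∂μ := by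
      rw [← integral_const_mul]
      exact convexOn_exp.map_integral_le Real.continuous_exp.continuousOn isClosed_univ
        (ae_of_all _ fun _ => Set.mem_univ _) (hint.const_mul _) (hexp _)
    have hmgf : mgf (fun x => f x - ∫ y, f y ∂μ) μ t =
        (∫ x, Real.exp (t * f x) ∂μ) * Real.exp (-t * ∫ x, f x ∂μ) := by
      rw [mgf, ← integral_mul_const]
      congr 1 with x
      rw [← Real.exp_add]
      ring_nf
    rw [hmgf]
    refine (mul_le_mul_of_nonneg_left hjensen
      (integral_nonneg fun x => (Real.exp_pos _).le)).trans (hmul.trans_eq ?_)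
    congr 1
    push_cast
    ring

end PropertyTau

/-! ### Concentration in the latent Gaussian model. -/

/-- The law of `x` in the model is that of `f z + S^{1/2} w`,
for independent standard Gaussian `z`, `w`. -/
theorem map_snd_joint {k d : ℕ}
    (f : EuclideanSpace ℝ (Fin k) → EuclideanSpace ℝ (Fin d)) (hf : Measurable f)
    (S : Matrix (Fin d) (Fin d) ℝ) :
    (joint f hf S).map Prod.snd =
      ((stdGaussian (EuclideanSpace ℝ (Fin k))).prod (stdGaussian (EuclideanSpace ℝ (Fin d)))).map
        fun p => f p.1 + Matrix.toEuclideanCLM (𝕜 := ℝ) (CFC.sqrt S) p.2 := by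
  refine Measure.ext_of_lintegral _ fun u hu => ?_
  rw [lintegral_map hu measurable_snd, lintegral_map hu (by fun_prop), joint,
    Measure.lintegral_compProd (by fun_prop), lintegral_prod _ (by fun_prop)]
  refine lintegral_congr fun z => ?_
  change ∫⁻ x, u x ∂(multivariateGaussian (f z) S) = _
  rw [multivariateGaussian, lintegral_map hu (by fun_prop)]

/-- The norm of `NN z + T w`, for independent standard Gaussian `z`, `w`, is sub-Gaussian. -/
theorem latent_hasSubgaussianMGF {k d : ℕ}
    {NN : EuclideanSpace ℝ (Fin k) → EuclideanSpace ℝ (Fin d)} {L₂ : ℝ≥0}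
    (hNN : LipschitzWith L₂ NN)
    (T : EuclideanSpace ℝ (Fin d) →L[ℝ] EuclideanSpace ℝ (Fin d)) :
    let γ := (stdGaussian (EuclideanSpace ℝ (Fin k))).prod
      (stdGaussian (EuclideanSpace ℝ (Fin d)))
    Integrable (fun p => ‖NN p.1 + T p.2‖) γ ∧
      HasSubgaussianMGF (fun p => ‖NN p.1 + T p.2‖ - ∫ q, ‖NN q.1 + T q.2‖ ∂γ)
        (2 * (‖T‖₊ ^ 2 + L₂ ^ 2)) γ := by
  have hm := hNN.continuous.measurable
  refine ((PropertyTau.stdGaussian k).prod (PropertyTau.stdGaussian d)).hasSubgaussianMGF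
    (f := fun p => ‖NN p.1 + T p.2‖) (by fun_prop) fun l p q => ?_
  have h₁ : ‖NN p.1 - NN q.1‖ ≤ L₂ * ‖p.1 - q.1‖ := by
    simpa [dist_eq_norm] using hNN.dist_le_mul p.1 q.1
  have h₂ : ‖T p.2 - T q.2‖ ≤ ‖T‖ * ‖p.2 - q.2‖ := by
    rw [← map_sub]
    exact T.le_opNorm _
  have h₃ : |‖NN p.1 + T p.2‖ - ‖NN q.1 + T q.2‖| ≤
      L₂ * ‖p.1 - q.1‖ + ‖T‖ * ‖p.2 - q.2‖ := by
    refine (abs_norm_sub_norm_le _ _).trans ?_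
    rw [add_sub_add_comm]
    exact (norm_add_le _ _).trans (add_le_add h₁ h₂)
  calc l * (‖NN p.1 + T p.2‖ - ‖NN q.1 + T q.2‖)
      ≤ |l| * (L₂ * ‖p.1 - q.1‖ + ‖T‖ * ‖p.2 - q.2‖) := by
        refine (le_abs_self _).trans ?_
        rw [abs_mul]
        exact mul_le_mul_of_nonneg_left h₃ (abs_nonneg _)
    _ ≤ |l| ^ 2 * (‖T‖ ^ 2 + L₂ ^ 2) + (‖p.1 - q.1‖ ^ 2 / 4 + ‖p.2 - q.2‖ ^ 2 / 4) := by
        -- Completing the square, `l L a ≤ l² L² + a² / 4`, separately in `z` and `w`.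
        nlinarith [sq_nonneg (|l| * L₂ - ‖p.1 - q.1‖ / 2), sq_nonneg (|l| * ‖T‖ - ‖p.2 - q.2‖ / 2)]
    _ = _ := by
        rw [sq_abs]
        push_cast
        rfl

/-! ### From the sub-Gaussian parameter to the stated tails. -/

theorem measureReal_le_abs_le {Ω : Type*} [MeasurableSpace Ω] {P : Measure Ω}
    [IsProbabilityMeasure P] {Y : Ω → ℝ} {c : ℝ≥0} (h : HasSubgaussianMGF Y c P) {t : ℝ}
    (ht : 0 ≤ t) : P.real {ω | t ≤ |Y ω|} ≤ 2 * Real.exp (-t ^ 2 / (2 * c)) := by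
  have hset : {ω | t ≤ |Y ω|} = {ω | t ≤ Y ω} ∪ {ω | t ≤ (-Y) ω} := by
    ext ω
    simp [le_abs]
  rw [hset, two_mul]
  exact (measureReal_union_le _ _).trans (add_le_add (h.measure_ge_le ht) (h.neg.measure_ge_le ht))

theorem expNegDiv_nonneg (a b : ℝ) : 0 ≤ expNegDiv a b := by
  unfold expNegDiv
  split_ifs <;> positivity

theorem exp_neg_div_le_expNegDiv {a b a' b' : ℝ} (hb : 0 < b) (hb' : 0 < b')
    (h : a' * b ≤ a * b') : Real.exp (-a / b) ≤ expNegDiv a' b' := by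
  rw [expNegDiv, if_neg hb'.ne', neg_div]
  exact Real.exp_le_exp.2 (neg_le_neg ((div_le_div_iff₀ hb' hb).2 h))

/-- Since `4 (L₁² + L₂²) ≤ 8 max (L₁, L₂)²`, one term suffices: the first if `L₂ ≤ L₁`, otherwise
the second, using `t² / 8 = (t / 2)² / 2 ≥ (t / 2 - s)² / 2`. -/
theorem measureReal_le_abs_le_expNegDiv {Ω : Type*} [MeasurableSpace Ω] {P : Measure Ω}
    [IsProbabilityMeasure P] {Y : Ω → ℝ} {L₁ L₂ : ℝ≥0}
    (h : HasSubgaussianMGF Y (2 * (L₁ ^ 2 + L₂ ^ 2)) P) {s t : ℝ} (hs : 0 ≤ s)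
    (ht : 2 * s < t) :
    P.real {ω | t ≤ |Y ω|} ≤ 2 * (expNegDiv (t ^ 2) (8 * (L₁ : ℝ) ^ 2) +
      expNegDiv ((t / 2 - s) ^ 2) (2 * (L₂ : ℝ) ^ 2)) := by
  have ht₀ : 0 < t := by linarith
  have n₁ := expNegDiv_nonneg (t ^ 2) (8 * (L₁ : ℝ) ^ 2)
  have n₂ := expNegDiv_nonneg ((t / 2 - s) ^ 2) (2 * (L₂ : ℝ) ^ 2)
  have htail := measureReal_le_abs_le h ht₀.le
  push_cast at htail
  have hst : (t / 2 - s) ^ 2 ≤ (t / 2) ^ 2 := pow_le_pow_left₀ (by linarith) (by linarith) 2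
  -- Here both terms are `0` by convention, while the Chernoff bound reads `2 exp 0` in Lean;
  -- instead the variable vanishes almost surely.
  by_cases hzero : L₁ = 0 ∧ L₂ = 0
  · obtain ⟨rfl, rfl⟩ := hzero
    have hae : Y =ᵐ[P] 0 :=
      HasSubgaussianMGF.ae_eq_zero_of_hasSubgaussianMGF_zero (by simpa using h)
    have h0 : P.real {ω | t ≤ |Y ω|} = 0 := by
      rw [measureReal_def, ENNReal.toReal_eq_zero_iff]
      refine Or.inl (measure_eq_zero_iff_ae_notMem.2 ?_)
      filter_upwards [hae] with ω hω
      simpa [hω] using ht₀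
    rw [h0]
    positivity
  rcases le_total L₂ L₁ with hL | hL
  · have h₁ : (0 : ℝ) < L₁ := by
      refine NNReal.coe_pos.2 (pos_iff_ne_zero.2 fun h₁ => hzero ⟨h₁, ?_⟩)
      exact le_antisymm (hL.trans h₁.le) zero_le
    have hL' : (L₂ : ℝ) ^ 2 ≤ (L₁ : ℝ) ^ 2 := pow_le_pow_left₀ L₂.2 hL 2
    have := exp_neg_div_le_expNegDiv (a := t ^ 2) (b := 2 * (2 * ((L₁ : ℝ) ^ 2 + (L₂ : ℝ) ^ 2)))
      (a' := t ^ 2) (b' := 8 * (L₁ : ℝ) ^ 2) (by positivity) (by positivity)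
      (mul_le_mul_of_nonneg_left (by linarith) (sq_nonneg t))
    linarith
  · have h₂ : (0 : ℝ) < L₂ := by
      refine NNReal.coe_pos.2 (pos_iff_ne_zero.2 fun h₂ => hzero ⟨?_, h₂⟩)
      exact le_antisymm (hL.trans h₂.le) zero_le
    have hL' : (L₁ : ℝ) ^ 2 ≤ (L₂ : ℝ) ^ 2 := pow_le_pow_left₀ L₁.2 hL 2
    have := exp_neg_div_le_expNegDiv (a := t ^ 2) (b := 2 * (2 * ((L₁ : ℝ) ^ 2 + (L₂ : ℝ) ^ 2)))
      (a' := (t / 2 - s) ^ 2) (b' := 2 * (L₂ : ℝ) ^ 2) (by positivity) (by positivity) (by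
        calc (t / 2 - s) ^ 2 * (2 * (2 * ((L₁ : ℝ) ^ 2 + (L₂ : ℝ) ^ 2)))
            ≤ (t / 2) ^ 2 * (8 * (L₂ : ℝ) ^ 2) :=
              mul_le_mul hst (by linarith) (by positivity) (by positivity)
          _ = _ := by ring)
    linarith

/-- A sub-Gaussian variable, up to a shift, has a Gaussian upper tail. -/
theorem exists_gaussian_tail {Ω : Type*} [MeasurableSpace Ω] {P : Measure Ω}
    [IsProbabilityMeasure P] {Y : Ω → ℝ} {m : ℝ} {c : ℝ≥0}
    (h : HasSubgaussianMGF (fun ω => Y ω - m) c P) :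
    ∃ C a : ℝ, 0 < C ∧ 0 < a ∧ ∀ t : ℝ, 0 ≤ t →
      P.real {ω | t ≤ Y ω} ≤ C * Real.exp (-(a * t ^ 2)) := by
  have hc : (0 : ℝ) < 2 * (c + 1) := by positivity
  -- Enlarging `c` to `c + 1` avoids a zero denominator.
  have h' : HasSubgaussianMGF (fun ω => Y ω - m) (c + 1) P :=
    ⟨h.integrable_exp_mul, fun t => (h.mgf_le t).trans (Real.exp_le_exp.2 (by
      push_cast
      nlinarith [sq_nonneg t]))⟩
  -- The constants come from `(t - m)² ≥ t² / 2 - m²`; for `t < m` the bound exceeds `1`.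
  refine ⟨Real.exp (m ^ 2 / (2 * (c + 1))), 1 / (2 * (2 * (c + 1))), Real.exp_pos _,
    by positivity, fun t ht => ?_⟩
  rw [← Real.exp_add]
  have hexp : m ^ 2 / (2 * ((c : ℝ) + 1)) + -(1 / (2 * (2 * (c + 1))) * t ^ 2) =
      (m ^ 2 - t ^ 2 / 2) / (2 * (c + 1)) := by
    field_simp
    ring
  rw [hexp]
  rcases le_or_gt m t with hmt | hmt
  · have := h'.measure_ge_le (sub_nonneg.2 hmt)
    simp only [sub_le_sub_iff_right] at this
    refine this.trans (Real.exp_le_exp.2 ?_)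
    push_cast
    refine div_le_div_of_nonneg_right ?_ hc.le
    nlinarith [sq_nonneg (t - 2 * m)]
  · refine measureReal_le_one.trans (Real.one_le_exp (div_nonneg ?_ hc.le))
    nlinarith

end GaussianLatentModel

open GaussianLatentModel in
theorem mainTheorem1 {k d : ℕ}
    (NN : EuclideanSpace ℝ (Fin k) → EuclideanSpace ℝ (Fin d)) (L₂ : ℝ≥0)
    (hNN : LipschitzWith L₂ NN)
    (S : Matrix (Fin d) (Fin d) ℝ) (hS : S.PosSemidef)
    {Ω : Type*} [MeasurableSpace Ω] (P : Measure Ω) [IsProbabilityMeasure P]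
    (Z : Ω → EuclideanSpace ℝ (Fin k)) (X : Ω → EuclideanSpace ℝ (Fin d))
    (hZX : HasLaw (fun ω => (Z ω, X ω)) (joint NN hNN.continuous.measurable S) P)
    (hint : Integrable (fun ω => ‖NN (Z ω)‖) P)
    (s : ℝ) (hs : s = Real.sqrt S.trace)
    (L₁ : ℝ) (hL₁ : L₁ = ‖Matrix.toEuclideanCLM (𝕜 := ℝ) (CFC.sqrt S)‖) :
    Integrable (fun ω => ‖X ω‖) P ∧
    (∀ t : ℝ, 2 * s < t →
      P.real {ω | t ≤ |‖X ω‖ - ∫ ω', ‖X ω'‖ ∂P|} ≤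
        2 * (expNegDiv (t ^ 2) (8 * L₁ ^ 2) +
          expNegDiv ((t / 2 - s) ^ 2) (2 * (L₂ : ℝ) ^ 2))) ∧
    (∃ C c : ℝ, 0 < C ∧ 0 < c ∧ ∀ t : ℝ, 0 ≤ t →
      P.real {ω | t ≤ ‖X ω‖} ≤ C * Real.exp (-(c * t ^ 2))) := by
  subst hs hL₁
  have hm := hNN.continuous.measurable
  have hX : AEMeasurable X P := hZX.aemeasurable.snd
  have hid : IdentDistrib (fun p : EuclideanSpace ℝ (Fin k) × EuclideanSpace ℝ (Fin d) =>
      NN p.1 + Matrix.toEuclideanCLM (𝕜 := ℝ) (CFC.sqrt S) p.2) X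
      ((stdGaussian _).prod (stdGaussian _)) P := by
    refine ⟨by fun_prop, hX, ?_⟩
    rw [← map_snd_joint NN hm S, ← hZX.map_eq,
      AEMeasurable.map_map_of_aemeasurable measurable_snd.aemeasurable hZX.aemeasurable]
    rfl
  have hnorm := hid.comp measurable_norm
  obtain ⟨hI, hsub⟩ :=
    latent_hasSubgaussianMGF hNN (Matrix.toEuclideanCLM (𝕜 := ℝ) (CFC.sqrt S))
  have hE := hnorm.integral_eq
  simp only [Function.comp_apply] at hE
  rw [hE] at hsub
  have hsubX := hsub.congr_identDistrib
    (hid.comp (u := fun x => ‖x‖ - ∫ ω', ‖X ω'‖ ∂P) (by fun_prop))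
  exact ⟨hnorm.integrable_iff.1 hI,
    fun t ht => measureReal_le_abs_le_expNegDiv hsubX (Real.sqrt_nonneg _) ht,
    exists_gaussian_tail hsubX⟩
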